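/- Let $\mathbb{F}_q$ be the finite field with $q$ elements, $A=\mathbb{F}_q[\theta]$, $K=\mathbb{F}_q(\theta)$, let $K_\infty=\mathbb{F}_q((1/\theta))$ be the completion of $K$ at the infinite place with the absolute value normalized by $|\theta|=q$, and let $\mathbb{C}_\infty$ be the completion of an algebraic closure of $K_\infty$, with the extended absolute value. For $d\ge 0$ let $A(d)$ be the set of polynomials in $A$ of degree $<d$ (so $A(0)=\{0\}$), $A_+(d)$ the set of monic polynomials of degree $d$, $D_d=\prod_{a\in A_+(d)}a$, $L_d$ the monic least common multiple of all polynomials of degree $d$ (so $D_0=L_0=1$), and $e_d(z)=\prod_{a\in A(d)}(z-a)$. For $t\in\mathbb{C}_\infty$ let $\chi_t:A\to\mathbb{C}_\infty$ be the $\mathbb{F}_q$-algebra morphism of evaluation $\theta\mapsto t$, and put $$M_d(\chi_t)(z)=\sum_{b\in A_+(d)}\chi_t(b)\prod_{a\in A_+(d)\setminus\{b\}}(z-a),\qquad b_d(\chi_t)=(-1)^d\frac{L_d}{D_d}M_d(\chi_t)(0).$$ Theorem. Let $t\in\mathbb{C}_\infty$ with $|t|<q$. Then for every $z\in\mathbb{C}_\infty$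 the Wagner series $$\sum_{j=0}^\infty b_j(\chi_t)\frac{e_j(z)}{D_j}$$ converges in $\mathbb{C}_\infty$. Its sum is an entire function of $z$, i.e. it is given on all of $\mathbb{C}_\infty$ by a single everywhere convergent power series in $z$, and it agrees with $\chi_t(z)$ for every $z\in A$. Thus it is an analytic interpolation of the quasi-character $\chi_t$. -/

import Mathlib

open scoped Polynomial NNReal

namespace Wagner

noncomputable section

/-! ### The field `C_∞`

`F` is the finite field with `q = Nat.card F` elements, `A = F[X]` (so `X` is the indeterminate
`θ`) and `K = RatFunc F`. -/

section Fields

variable (F : Type*) [Field F]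

open scoped Classical in
/-- `K_∞ = F((1/θ))`: the completion of `K = F(θ)` at the place at infinity. -/
def KInfty : Type _ := RatFunc.CompletionAtInfty F

namespace KInfty

open scoped Classical in
instance : Field (KInfty F) := inferInstanceAs (Field (RatFunc.CompletionAtInfty F))

open scoped Classical in
instance : Algebra (RatFunc F) (KInfty F) :=
  inferInstanceAs (Algebra (RatFunc F) (RatFunc.CompletionAtInfty F))

open scoped Classical in
instance : Valued (KInfty F) (WithZero (Multiplicative ℤ)) :=
  inferInstanceAs (Valued (RatFunc.CompletionAtInfty F) (WithZero (Multiplicative ℤ)))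

open scoped Classical in
instance : CompleteSpace (KInfty F) :=
  letI : UniformSpace (RatFunc F) := (RatFunc.inftyValued F).toUniformSpace
  inferInstanceAs (CompleteSpace (UniformSpace.Completion (RatFunc F)))

open scoped Classical in
theorem valued_algebraMap (x : RatFunc F) :
    Valued.v (algebraMap (RatFunc F) (KInfty F) x) = RatFunc.inftyValuation F x :=
  letI := RatFunc.inftyValued F
  Valued.extensionValuation_apply_coe x

theorem valued_X :
    Valued.v (algebraMap (RatFunc F) (KInfty F) RatFunc.X) = WithZero.exp (1 : ℤ) := by
  classical
  rw [valued_algebraMap, RatFunc.inftyValuation.X]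

end KInfty

variable [Finite F]

theorem one_lt_q : (1 : ℝ≥0) < (Nat.card F : ℝ≥0) := by
  exact_mod_cast Finite.one_lt_card

namespace KInfty

/-- The valuation on `K_∞` is made real valued by `exp n ↦ q ^ n`, so that `|θ| = q`. -/
instance : (Valued.v : Valuation (KInfty F) (WithZero (Multiplicative ℤ))).RankOne where
  hom' := (WithZeroMulInt.toNNReal (one_lt_q F).ne_zero).comp
    MonoidWithZeroHom.ValueGroup₀.embedding
  strictMono' := (WithZeroMulInt.toNNReal_strictMono (one_lt_q F)).comp
    MonoidWithZeroHom.ValueGroup₀.embedding_strictMono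
  exists_val_nontrivial := ⟨algebraMap (RatFunc F) (KInfty F) RatFunc.X, by
    rw [valued_X]; exact ⟨by simp, by simp⟩⟩

instance : NormedField (KInfty F) := Valued.toNormedField _ (WithZero (Multiplicative ℤ))

theorem norm_X : ‖algebraMap (RatFunc F) (KInfty F) RatFunc.X‖ = Nat.card F := by
  change ((WithZeroMulInt.toNNReal (one_lt_q F).ne_zero
    (MonoidWithZeroHom.ValueGroup₀.embedding (Valued.v.restrict
      (algebraMap (RatFunc F) (KInfty F) RatFunc.X))) : ℝ≥0) : ℝ) = _
  rw [Valuation.embedding_restrict, valued_X]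
  rw [WithZeroMulInt.toNNReal_neg_apply _ WithZero.exp_ne_zero]
  simp [WithZero.exp]

instance : NontriviallyNormedField (KInfty F) where
  non_trivial := ⟨_, by rw [norm_X]; exact_mod_cast one_lt_q F⟩

instance : IsUltrametricDist (KInfty F) :=
  ⟨fun x y z => by
    have h := Valuation.norm_add_le (Valued.v : Valuation (KInfty F) _) (x - y) (y - z)
    rw [sub_add_sub_cancel] at h
    exact h⟩

end KInfty

/-- An algebraic closure of `K_∞`. -/
def KInftyBar : Type _ := AlgebraicClosure (KInfty F)

namespace KInftyBar

instance : Field (KInftyBar F) := inferInstanceAs (Field (AlgebraicClosure (KInfty F)))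

instance : Algebra (KInfty F) (KInftyBar F) :=
  inferInstanceAs (Algebra (KInfty F) (AlgebraicClosure (KInfty F)))

instance : IsAlgClosure (KInfty F) (KInftyBar F) :=
  inferInstanceAs (IsAlgClosure (KInfty F) (AlgebraicClosure (KInfty F)))

instance : Algebra.IsAlgebraic (KInfty F) (KInftyBar F) := IsAlgClosure.isAlgebraic

/-- The spectral norm: the unique extension of the absolute value of `K_∞` to its algebraic closure. -/
instance : NontriviallyNormedField (KInftyBar F) :=
  spectralNorm.nontriviallyNormedField (KInfty F) (KInftyBar F)

theorem norm_algebraMap (x : KInfty F) : ‖algebraMap (KInfty F) (KInftyBar F) x‖ = ‖x‖ :=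
  spectralNorm_extends x

end KInftyBar

/-- `C_∞`: the completion of the algebraic closure of `K_∞`, with the extended absolute value. -/
def CInfty : Type _ := UniformSpace.Completion (KInftyBar F)

namespace CInfty

instance : NormedField (CInfty F) :=
  inferInstanceAs (NormedField (UniformSpace.Completion (KInftyBar F)))

instance : CompleteSpace (CInfty F) :=
  inferInstanceAs (CompleteSpace (UniformSpace.Completion (KInftyBar F)))

/-- The embedding of the algebraic closure of `K_∞` into `C_∞`. -/
def ofBar : KInftyBar F →+* CInfty F := UniformSpace.Completion.coeRingHom

theorem norm_ofBar (x : KInftyBar F) : ‖ofBar F x‖ = ‖x‖ :=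
  UniformSpace.Completion.norm_coe x

/-- The embedding of `A = F[θ]` into `C_∞`, through `K`, `K_∞` and its algebraic closure. -/
def ofA : F[X] →+* CInfty F :=
  (ofBar F).comp ((algebraMap (KInfty F) (KInftyBar F)).comp
    ((algebraMap (RatFunc F) (KInfty F)).comp (algebraMap F[X] (RatFunc F))))

instance : Algebra F[X] (CInfty F) := (ofA F).toAlgebra

instance : Algebra F (CInfty F) := ((ofA F).comp Polynomial.C).toAlgebra

instance : IsScalarTower F F[X] (CInfty F) := IsScalarTower.of_algebraMap_eq fun _ => rfl

/-- The absolute value on `C_∞` is normalized by `|θ| = q`. -/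
theorem norm_theta : ‖algebraMap F[X] (CInfty F) Polynomial.X‖ = Nat.card F := by
  change ‖ofBar F (algebraMap (KInfty F) (KInftyBar F)
    (algebraMap (RatFunc F) (KInfty F) (algebraMap F[X] (RatFunc F) Polynomial.X)))‖ = _
  rw [norm_ofBar, KInftyBar.norm_algebraMap, RatFunc.algebraMap_X, KInfty.norm_X]

instance : NontriviallyNormedField (CInfty F) where
  non_trivial := ⟨_, by rw [norm_theta]; exact_mod_cast one_lt_q F⟩

end CInfty

end Fields

/-! ### Carlitz polynomials -/

section Carlitz

variable (F : Type*) [Field F] [Finite F]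

theorem finite_degree_lt (d : ℕ) : {a : F[X] | a.degree < d}.Finite := by
  have : Finite (Polynomial.degreeLT F d) :=
    Finite.of_equiv _ (Polynomial.degreeLTEquiv F d).symm.toEquiv
  exact (Set.toFinite (Polynomial.degreeLT F d : Set F[X])).subset
    fun a ha => Polynomial.mem_degreeLT.2 ha

theorem finite_degree_eq (d : ℕ) : {a : F[X] | a.degree = d}.Finite :=
  (finite_degree_lt F (d + 1)).subset fun a (ha : a.degree = d) => by
    change a.degree < _
    rw [ha]; exact_mod_cast Nat.lt_succ_self d

/-- `A(d)`: the polynomials of degree strictly less than `d` (`A(0) = {0}`). -/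
def polyLT (d : ℕ) : Finset F[X] := (finite_degree_lt F d).toFinset

/-- The polynomials of degree exactly `d`. -/
def polyEq (d : ℕ) : Finset F[X] := (finite_degree_eq F d).toFinset

open scoped Classical in
/-- `A_+(d)`: the monic polynomials of degree `d`. -/
def monics (d : ℕ) : Finset F[X] := (polyEq F d).filter Polynomial.Monic

variable {F} in
@[simp]
theorem mem_polyLT {d : ℕ} {a : F[X]} : a ∈ polyLT F d ↔ a.degree < d := by
  simp [polyLT]

variable {F} in
@[simp]
theorem mem_polyEq {d : ℕ} {a : F[X]} : a ∈ polyEq F d ↔ a.degree = d := by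
  simp [polyEq]

variable {F} in
@[simp]
theorem mem_monics {d : ℕ} {a : F[X]} : a ∈ monics F d ↔ a.degree = d ∧ a.Monic := by
  simp [monics]

/-- `D_d`: the product of all monic polynomials of degree `d`. -/
def D (d : ℕ) : F[X] := ∏ a ∈ monics F d, a

open scoped Classical in
/-- `L_d`: the (monic) least common multiple of all polynomials of degree `d`. -/
def L (d : ℕ) : F[X] := (polyEq F d).lcm id

theorem L_dvd_iff (d : ℕ) (m : F[X]) : L F d ∣ m ↔ ∀ a : F[X], a.degree = d → a ∣ m := by
  simp [L, Finset.lcm_dvd_iff]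

theorem L_monic (d : ℕ) : (L F d).Monic := by
  classical
  have h0 : L F d ≠ 0 := fun h => by
    have h1 := (L_dvd_iff F d (∏ a ∈ polyEq F d, a)).2
      fun a ha => Finset.dvd_prod_of_mem _ (mem_polyEq.2 ha)
    rw [h, zero_dvd_iff, Finset.prod_eq_zero_iff] at h1
    obtain ⟨a, ha, rfl⟩ := h1
    simp at ha
  have h2 : normalize (L F d) = L F d := Finset.normalize_lcm
  rw [← h2]
  exact Polynomial.monic_normalize h0

/-- `e_d(z) = ∏_{a ∈ A(d)} (z - a)`, a polynomial in `z` over `A`. -/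
def e (d : ℕ) : F[X][X] := ∏ a ∈ polyLT F d, (Polynomial.X - Polynomial.C a)

variable {F} {B : Type*} [Field B] [Algebra F[X] B]

open scoped Classical in
/-- The Carlitz approximation to `f : A → B` on `A_+(d)`:
`M_d(f)(z) = ∑_{b ∈ A_+(d)} f(b) ∏_{a ∈ A_+(d) \ {b}} (z - a)`. -/
def M (d : ℕ) (f : F[X] → B) : B[X] :=
  ∑ b ∈ monics F d, Polynomial.C (f b) *
    ∏ a ∈ (monics F d).erase b, (Polynomial.X - Polynomial.C (algebraMap F[X] B a))

/-- The Wagner coefficient `b_j(f) = (-1)^j (L_j / D_j) M_j(f)(0)`. -/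
def wagnerCoeff (j : ℕ) (f : F[X] → B) : B :=
  (-1) ^ j * (algebraMap F[X] B (L F j) / algebraMap F[X] B (D F j)) * (M j f).eval 0

/-- The `j`-th term `b_j(f) e_j(z) / D_j` of the Wagner series of `f`. -/
def wagnerTerm (f : F[X] → B) (z : B) (j : ℕ) : B :=
  wagnerCoeff j f * (Polynomial.aeval z (e F j) / algebraMap F[X] B (D F j))

end Carlitz

/-- The quasi-character `χ_t : A → C_∞`: the `F`-algebra morphism of evaluation `θ ↦ t`. -/
def chi {F : Type*} [Field F] [Finite F] (t : CInfty F) : F[X] →ₐ[F] CInfty F :=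
  Polynomial.aeval t

end

end Wagner

/-! Write q = `Nat.card F`, E_d = e_d / D_d and [d] = θ^(q^d) - θ. The e_d are F-linear, and e_(d+1)
= e_d^q - D_d^(q-1) e_d leads to E_(d+1)(θz) = θ^(q^(d+1)) E_(d+1)(z) + E_d(z)
(`carlitzE_theta_mul`). With c_j = ∏_(i<j) (t - θ^(q^i)), this rule yields a(t) = Σ_j c_j E_j(a) for
a in A, a finite sum since E_j(a) = 0 for j > deg a (`sum_evalCoeff_mul_carlitzE`).

The c_j are exactly the Wagner coefficients of χ_t (`wagnerCoeff_aeval`): E_d = 1 on the monic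
polynomials of degree d, so Σ_(j<d) c_j E_j + c_d interpolates χ_t there and takes the value c_d at
0. The factor (-1)^d L_d / D_d is the right normalization because L_d = [1]⋯[d] (`L_eq`).

If |t| < q then |t - θ^(q^i)| ≤ q^(q^i), whereas |D_d| = q^(d q^d). On each disc the bounds for the
terms eventually shrink by a ratio of at most 1/q (`summable_norm_mul_eBound`), and this allows the
series of polynomials to be rearranged into one everywhere convergent power series
(`exists_hasFPowerSeriesOnBall_tsum_eval`). -/

namespace Wagner

/-! ### Frobenius identities and products over A(d) and A_+(d). -/

section Basic

theorem prod_X_sub_C_eq {F : Type*} [Field F] [Fintype F] :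
    ∏ c : F, (Polynomial.X - Polynomial.C c) = (Polynomial.X ^ Nat.card F - Polynomial.X : F[X]) := by
  have hq : 1 < Fintype.card F := Fintype.one_lt_card
  have hr := FiniteField.roots_X_pow_card_sub_X F
  have h := Polynomial.prod_multiset_X_sub_C_of_monic_of_roots_card_eq
    (p := (Polynomial.X ^ Fintype.card F - Polynomial.X : F[X]))
    (Polynomial.monic_X_pow_sub (by simpa using hq)) (by
      rw [hr, FiniteField.X_pow_card_sub_X_natDegree_eq F hq]; simp)
  rw [hr] at h
  rw [Nat.card_eq_fintype_card, ← h]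
  rfl

variable {F : Type*} [Field F] [Finite F]

theorem frobenius_add {B : Type*} [CommRing B] [Algebra F B] (x y : B) :
    (x + y) ^ Nat.card F = x ^ Nat.card F + y ^ Nat.card F := by
  have := Fintype.ofFinite F
  simpa [Nat.card_eq_fintype_card] using map_add (FiniteField.frobeniusAlgHom F B) x y

theorem frobenius_sub {B : Type*} [CommRing B] [Algebra F B] (x y : B) :
    (x - y) ^ Nat.card F = x ^ Nat.card F - y ^ Nat.card F := by
  have := Fintype.ofFinite F
  simpa [Nat.card_eq_fintype_card] using map_sub (FiniteField.frobeniusAlgHom F B) x y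

theorem frobenius_smul {B : Type*} [CommRing B] [Algebra F B] (c : F) (x : B) :
    (c • x) ^ Nat.card F = c • x ^ Nat.card F := by
  have := Fintype.ofFinite F
  rw [Nat.card_eq_fintype_card]
  exact map_smul (FiniteField.frobeniusAlgHom F B) c x

/-- Homogenization of ∏ (X - c) = X^q - X: evaluate at x / y and multiply by y^q. -/
theorem prod_sub_smul_of_field [Fintype F] {B : Type*} [Field B] [Algebra F B] (x y : B) :
    ∏ c : F, (x - c • y) = x ^ Nat.card F - y ^ (Nat.card F - 1) * x := by
  have hq : 1 < Nat.card F := Finite.one_lt_card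
  rcases eq_or_ne y 0 with rfl | hy
  · rw [zero_pow (Nat.sub_ne_zero_of_lt hq)]
    simp [Nat.card_eq_fintype_card]
  · have h := congrArg (fun p => y ^ Nat.card F * Polynomial.aeval (x / y) p)
      (prod_X_sub_C_eq (F := F))
    simp only [map_prod, map_sub, Polynomial.aeval_X, Polynomial.aeval_C, map_pow] at h
    rw [Nat.card_eq_fintype_card, ← Finset.card_univ, ← Finset.prod_const,
      ← Finset.prod_mul_distrib, Finset.prod_const, Finset.card_univ,
      ← Nat.card_eq_fintype_card] at h
    have h1 : ∀ c : F, y * (x / y - algebraMap F B c) = x - c • y := fun c => by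
      rw [Algebra.smul_def]; field_simp
    have h2 : y ^ Nat.card F = y ^ (Nat.card F - 1) * y := by
      rw [← pow_succ, Nat.sub_add_cancel hq.le]
    rw [Finset.prod_congr rfl fun c _ => h1 c] at h
    rw [h, mul_sub, div_pow, mul_div_cancel₀ _ (pow_ne_zero _ hy), h2]
    field_simp

/-- Stated for domains because the recursion for e_d is also applied in the polynomial ring `B[X]`.
-/
theorem prod_sub_smul [Fintype F] {B : Type*} [CommRing B] [IsDomain B] [Algebra F B] (x y : B) :
    ∏ c : F, (x - c • y) = x ^ Nat.card F - y ^ (Nat.card F - 1) * x := by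
  apply IsFractionRing.injective B (FractionRing B)
  simpa [Algebra.smul_def, ← IsScalarTower.algebraMap_apply] using
    prod_sub_smul_of_field (F := F) (algebraMap B (FractionRing B) x) (algebraMap B (FractionRing B) y)

/-- A(d+1) is the disjoint union of the translates A(d) + cθ^d. A general monoid lets this serve for
e_d, for real norm bounds and for cardinalities. -/
theorem prod_polyLT_succ [Fintype F] {M : Type*} [CommMonoid M] (d : ℕ) (f : F[X] → M) :
    ∏ a ∈ polyLT F (d + 1), f a =
      ∏ c : F, ∏ a ∈ polyLT F d, f (a + Polynomial.C c * Polynomial.X ^ d) := by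
  rw [← Finset.prod_product']
  symm
  refine Finset.prod_bij' (fun p _ => p.2 + Polynomial.C p.1 * Polynomial.X ^ d)
    (fun a _ => (a.coeff d, a - Polynomial.C (a.coeff d) * Polynomial.X ^ d)) ?_ ?_ ?_ ?_ ?_
  · rintro ⟨c, a⟩ h
    simp only [Finset.mem_product, Finset.mem_univ, mem_polyLT, true_and] at h ⊢
    refine (Polynomial.degree_add_le _ _).trans_lt (max_lt (h.trans ?_) ?_)
    · exact_mod_cast Nat.lt_succ_self d
    · exact (Polynomial.degree_C_mul_X_pow_le _ _).trans_lt (by exact_mod_cast Nat.lt_succ_self d)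
  · intro a h
    simp only [Finset.mem_product, Finset.mem_univ, mem_polyLT, true_and] at h ⊢
    rw [Polynomial.degree_lt_iff_coeff_zero] at h ⊢
    intro m hm
    rcases hm.eq_or_lt with rfl | hm
    · simp
    · simp [Polynomial.coeff_X_pow, hm.ne', h m hm]
  · rintro ⟨c, a⟩ h
    simp only [Finset.mem_product, Finset.mem_univ, mem_polyLT, true_and] at h
    have := Polynomial.coeff_eq_zero_of_degree_lt h
    simp [this]
  · intro a h
    simp
  · intro a h
    rfl

theorem prod_polyLT_neg {M : Type*} [CommMonoid M] (d : ℕ) (f : F[X] → M) :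
    ∏ a ∈ polyLT F d, f (-a) = ∏ a ∈ polyLT F d, f a :=
  Finset.prod_bij' (fun a _ => -a) (fun a _ => -a) (by simp) (by simp) (by simp) (by simp) (by simp)

theorem prod_monics {M : Type*} [CommMonoid M] (d : ℕ) (f : F[X] → M) :
    ∏ b ∈ monics F d, f b = ∏ a ∈ polyLT F d, f (Polynomial.X ^ d + a) := by
  symm
  refine Finset.prod_bij' (fun a _ => Polynomial.X ^ d + a)
    (fun b _ => b - Polynomial.X ^ d) ?_ ?_ ?_ ?_ ?_
  · intro a h
    simp only [mem_polyLT, mem_monics] at h ⊢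
    have h' : a.degree < (Polynomial.X ^ d : F[X]).degree := by simpa using h
    exact ⟨by rw [Polynomial.degree_add_eq_left_of_degree_lt h']; simp,
      (Polynomial.monic_X_pow d).add_of_left h'⟩
  · intro a h
    simp only [mem_polyLT, mem_monics] at h ⊢
    have := Polynomial.degree_sub_lt_left (p := a) (q := (Polynomial.X ^ d : F[X]))
      (by simp [h.1]) h.2.ne_zero (by simp [h.2.leadingCoeff])
    rwa [h.1] at this
  · intro a _; simp
  · intro a _; simp
  · intro a _; rfl

theorem card_polyLT (d : ℕ) : (polyLT F d).card = Nat.card F ^ d := by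
  have := Fintype.ofFinite F
  induction d with
  | zero =>
    rw [Finset.card_eq_one.2 ⟨0, by ext; simp⟩, pow_zero]
  | succ d ih =>
    -- A product of copies of 1 in `Multiplicative ℕ` counts the index set.
    have h := prod_polyLT_succ (F := F) d (fun _ => Multiplicative.ofAdd (1 : ℕ))
    simp only [Finset.prod_const, Finset.card_univ, ih] at h
    have h' := congrArg Multiplicative.toAdd h
    simpa [pow_succ, Nat.card_eq_fintype_card, mul_comm] using h'

theorem card_monics (d : ℕ) : (monics F d).card = Nat.card F ^ d := by
  have h := prod_monics (F := F) d (fun _ => Multiplicative.ofAdd (1 : ℕ))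
  simp only [Finset.prod_const, card_polyLT] at h
  simpa using congrArg Multiplicative.toAdd h

end Basic

/-! ### Linearity, recursion and derivative of e_d. -/

section AdditivePolynomial

variable {F : Type*} [Field F] [Finite F] {B : Type*} [CommRing B] [Algebra F[X] B]

theorem aeval_e (d : ℕ) (x : B) :
    Polynomial.aeval x (e F d) = ∏ a ∈ polyLT F d, (x - algebraMap F[X] B a) := by
  simp [e, map_prod]

theorem aeval_e_zero (x : B) : Polynomial.aeval x (e F 0) = x := by
  have h : polyLT F 0 = {0} := by ext; simp
  simp [aeval_e, h]

theorem aeval_e_eq_zero {d : ℕ} {a : F[X]} (ha : a.degree < d) :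
    Polynomial.aeval (algebraMap F[X] B a) (e F d) = 0 := by
  rw [aeval_e]
  exact Finset.prod_eq_zero (mem_polyLT.2 ha) (sub_self _)

theorem aeval_e_X_pow (d : ℕ) :
    Polynomial.aeval (algebraMap F[X] B (Polynomial.X ^ d)) (e F d) = algebraMap F[X] B (D F d) := by
  rw [aeval_e, D, prod_monics, map_prod, ← prod_polyLT_neg]
  simp

variable [IsDomain B] [Algebra F B] [IsScalarTower F F[X] B]

/-- Linearity of e_d turns the factor over A(d) + cθ^d into e_d(x) - c D_d, since e_d(θ^d) = D_d.
Linearity is a hypothesis so that it and the recursion can be proved by one induction. -/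
theorem aeval_e_succ_of_additive {d : ℕ}
    (hadd : ∀ x y : B, Polynomial.aeval (x - y) (e F d) =
      Polynomial.aeval x (e F d) - Polynomial.aeval y (e F d))
    (hsmul : ∀ (c : F) (x : B), Polynomial.aeval (c • x) (e F d) = c • Polynomial.aeval x (e F d))
    (x : B) :
    Polynomial.aeval x (e F (d + 1)) = Polynomial.aeval x (e F d) ^ Nat.card F -
      algebraMap F[X] B (D F d) ^ (Nat.card F - 1) * Polynomial.aeval x (e F d) := by
  have := Fintype.ofFinite F
  rw [aeval_e, prod_polyLT_succ, ← prod_sub_smul]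
  refine Finset.prod_congr rfl fun c _ => ?_
  rw [← aeval_e_X_pow, ← hsmul, ← hadd, aeval_e]
  refine Finset.prod_congr rfl fun a _ => ?_
  rw [map_add, ← Polynomial.smul_eq_C_mul, Algebra.smul_def, Algebra.smul_def, map_mul,
    ← IsScalarTower.algebraMap_apply]
  ring

theorem aeval_e_additive (d : ℕ) :
    (∀ x y : B, Polynomial.aeval (x - y) (e F d) =
      Polynomial.aeval x (e F d) - Polynomial.aeval y (e F d)) ∧
    ∀ (c : F) (x : B), Polynomial.aeval (c • x) (e F d) = c • Polynomial.aeval x (e F d) := by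
  induction d with
  | zero => simp [aeval_e_zero]
  | succ d ih =>
    have h := aeval_e_succ_of_additive ih.1 ih.2
    refine ⟨fun x y => ?_, fun c x => ?_⟩
    · rw [h, h, h, ih.1, frobenius_sub (F := F)]
      ring
    · rw [h, h, ih.2, frobenius_smul, smul_sub, mul_smul_comm]

theorem aeval_e_succ (d : ℕ) (x : B) :
    Polynomial.aeval x (e F (d + 1)) = Polynomial.aeval x (e F d) ^ Nat.card F -
      algebraMap F[X] B (D F d) ^ (Nat.card F - 1) * Polynomial.aeval x (e F d) :=
  aeval_e_succ_of_additive (aeval_e_additive d).1 (aeval_e_additive d).2 x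

theorem aeval_e_sub (d : ℕ) (x y : B) : Polynomial.aeval (x - y) (e F d) =
    Polynomial.aeval x (e F d) - Polynomial.aeval y (e F d) :=
  (aeval_e_additive d).1 x y

theorem aeval_e_add (d : ℕ) (x y : B) : Polynomial.aeval (x + y) (e F d) =
    Polynomial.aeval x (e F d) + Polynomial.aeval y (e F d) := by
  have h := aeval_e_sub (F := F) d (x + y) y
  rw [add_sub_cancel_right] at h
  rw [h, sub_add_cancel]

variable (F) in
theorem natCast_card_eq_zero (B : Type*) [CommRing B] [Algebra F B] : (Nat.card F : B) = 0 := by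
  have := Fintype.ofFinite F
  rw [← map_natCast (algebraMap F B), Nat.card_eq_fintype_card, Nat.cast_card_eq_zero, map_zero]

variable (F) in
/-- The constant derivative of the additive polynomial `e_d`. -/
noncomputable def kappa (d : ℕ) : F[X] := (-1) ^ d * ∏ i ∈ Finset.range d, D F i ^ (Nat.card F - 1)

theorem derivative_aeval_e (d : ℕ) :
    Polynomial.derivative (Polynomial.aeval (Polynomial.X : B[X]) (e F d)) =
      Polynomial.C (algebraMap F[X] B (kappa F d)) := by
  induction d with
  | zero => simp [aeval_e_zero, kappa]
  | succ d ih =>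
    rw [aeval_e_succ, Polynomial.algebraMap_apply, ← Polynomial.C_pow, Polynomial.derivative_sub,
      Polynomial.derivative_pow, natCast_card_eq_zero F B, Polynomial.derivative_C_mul, ih,
      ← map_mul]
    simp [kappa, Finset.prod_range_succ, pow_succ]
    ring

end AdditivePolynomial

/-! ### The normalized polynomials E_d and multiplication by θ. -/

section CarlitzBinomial

variable {F : Type*} [Field F] [Finite F] {B : Type*} [Field B] [Algebra F[X] B]

theorem D_monic (d : ℕ) : (D F d).Monic :=
  Polynomial.monic_prod_of_monic _ _ fun _ ha => (mem_monics.1 ha).2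

variable (F) in
/-- The Carlitz polynomial function `E_d(z) = e_d(z) / D_d`. -/
noncomputable def carlitzE (d : ℕ) (z : B) : B :=
  Polynomial.aeval z (e F d) / algebraMap F[X] B (D F d)

variable (F) in
/-- The Carlitz bracket `[d] = θ ^ q ^ d - θ`. -/
noncomputable def bracket (d : ℕ) : F[X] := Polynomial.X ^ Nat.card F ^ d - Polynomial.X

theorem bracket_succ_monic (d : ℕ) : (bracket F (d + 1)).Monic :=
  Polynomial.monic_X_pow_sub (by
    rw [Polynomial.degree_X]; exact_mod_cast Nat.one_lt_pow d.succ_ne_zero Finite.one_lt_card)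

theorem carlitzE_zero (z : B) : carlitzE F 0 z = z := by
  have h : monics F 0 = {1} := by
    ext a
    simp only [mem_monics, Finset.mem_singleton]
    refine ⟨fun h => ?_, fun h => by simp [h]⟩
    exact (h.2.natDegree_eq_zero.1 (Polynomial.natDegree_eq_of_degree_eq_some h.1))
  simp [carlitzE, aeval_e_zero, D, h]

theorem carlitzE_eq_zero {d : ℕ} {a : F[X]} (ha : a.degree < d) :
    carlitzE F d (algebraMap F[X] B a) = 0 := by
  simp [carlitzE, aeval_e_eq_zero ha]

theorem carlitzE_add [Algebra F B] [IsScalarTower F F[X] B] (d : ℕ)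
    (x y : B) : carlitzE F d (x + y) = carlitzE F d x + carlitzE F d y := by
  rw [carlitzE, aeval_e_add, add_div]; rfl

variable [FaithfulSMul F[X] B]

theorem algebraMap_D_ne_zero (d : ℕ) : algebraMap F[X] B (D F d) ≠ 0 := by
  rw [Ne, FaithfulSMul.algebraMap_eq_zero_iff]
  exact (D_monic d).ne_zero

theorem carlitzE_X_pow (d : ℕ) : carlitzE F d (algebraMap F[X] B Polynomial.X ^ d) = 1 := by
  rw [carlitzE, ← map_pow, aeval_e_X_pow, div_self (algebraMap_D_ne_zero d)]

theorem algebraMap_bracket_succ_ne_zero (d : ℕ) : algebraMap F[X] B (bracket F (d + 1)) ≠ 0 := by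
  rw [Ne, FaithfulSMul.algebraMap_eq_zero_iff]
  exact (bracket_succ_monic d).ne_zero

variable [Algebra F B] [IsScalarTower F F[X] B]

theorem carlitzE_of_monic {d : ℕ} {b : F[X]} (hb : b ∈ monics F d) :
    carlitzE F d (algebraMap F[X] B b) = 1 := by
  rw [mem_monics] at hb
  have h := Polynomial.degree_sub_lt_left (p := b) (q := (Polynomial.X ^ d : F[X]))
      (by simp [hb.1]) hb.2.ne_zero (by simp [hb.2.leadingCoeff])
  rw [hb.1] at h
  rw [← add_sub_cancel (Polynomial.X ^ d) b, map_add, carlitzE_add, carlitzE_eq_zero h, map_pow,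
    carlitzE_X_pow, add_zero]

theorem aeval_e_succ_eq (d : ℕ) (z : B) :
    Polynomial.aeval z (e F (d + 1)) =
      algebraMap F[X] B (D F d) ^ Nat.card F * (carlitzE F d z ^ Nat.card F - carlitzE F d z) := by
  have hq : 1 < Nat.card F := Finite.one_lt_card
  have hD := algebraMap_D_ne_zero (F := F) (B := B) d
  have h2 : algebraMap F[X] B (D F d) ^ Nat.card F =
      algebraMap F[X] B (D F d) ^ (Nat.card F - 1) * algebraMap F[X] B (D F d) := by
    rw [← pow_succ, Nat.sub_add_cancel hq.le]
  rw [aeval_e_succ, mul_sub, ← mul_pow, carlitzE, mul_div_cancel₀ _ hD, h2, mul_assoc,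
    mul_div_cancel₀ _ hD]

/-- The relation of the Carlitz polynomials `E_d` with multiplication by `θ`, proved together with
the recursions that it needs. -/
theorem carlitzE_recursion (d : ℕ) :
    (algebraMap F[X] B (D F (d + 1)) =
      algebraMap F[X] B (bracket F (d + 1)) * algebraMap F[X] B (D F d) ^ Nat.card F) ∧
    (∀ z : B, carlitzE F d z ^ Nat.card F - carlitzE F d z =
      algebraMap F[X] B (bracket F (d + 1)) * carlitzE F (d + 1) z) ∧
    (∀ z : B, carlitzE F (d + 1) (algebraMap F[X] B Polynomial.X * z) =
      algebraMap F[X] B Polynomial.X ^ Nat.card F ^ (d + 1) * carlitzE F (d + 1) z +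
        carlitzE F d z) := by
  set θ := algebraMap F[X] B Polynomial.X with hθ
  have hbr : ∀ d, algebraMap F[X] B (bracket F d) = θ ^ Nat.card F ^ d - θ := fun d => by
    simp [bracket, hθ]
  -- Here g stands for E_(d-1), or for 0 when d = 0, which gives the base case and the inductive
  -- step the same proof.
  have key : ∀ d (g : B → B),
      (∀ z, carlitzE F d (θ * z) = θ ^ Nat.card F ^ d * carlitzE F d z + g z) →
      (∀ z, g z ^ Nat.card F - g z = (θ ^ Nat.card F ^ d - θ) * carlitzE F d z) →
      (carlitzE F d (θ ^ (d + 1)) ^ Nat.card F - carlitzE F d (θ ^ (d + 1)) =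
          θ ^ Nat.card F ^ (d + 1) - θ) ∧
      (algebraMap F[X] B (D F (d + 1)) =
        algebraMap F[X] B (bracket F (d + 1)) * algebraMap F[X] B (D F d) ^ Nat.card F) ∧
      (∀ z : B, carlitzE F d z ^ Nat.card F - carlitzE F d z =
        algebraMap F[X] B (bracket F (d + 1)) * carlitzE F (d + 1) z) ∧
      (∀ z : B, carlitzE F (d + 1) (θ * z) =
        θ ^ Nat.card F ^ (d + 1) * carlitzE F (d + 1) z + carlitzE F d z) := by
    intro d g h1 h2
    have hs : carlitzE F d (θ ^ (d + 1)) ^ Nat.card F - carlitzE F d (θ ^ (d + 1)) =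
          θ ^ Nat.card F ^ (d + 1) - θ := by
      have h3 := h2 (θ ^ d)
      rw [carlitzE_X_pow, mul_one] at h3
      -- E_d(θ^(d+1)) = θ^(q^d) + g(θ^d), and g^q - g equals θ^(q^d) - θ at θ^d, so the terms
      -- θ^(q^d) cancel.
      rw [pow_succ' θ d, h1, carlitzE_X_pow, mul_one, frobenius_add (F := F), ← pow_mul,
        ← pow_succ]
      linear_combination h3
    have hDs : algebraMap F[X] B (D F (d + 1)) =
        algebraMap F[X] B (bracket F (d + 1)) * algebraMap F[X] B (D F d) ^ Nat.card F := by
      rw [← aeval_e_X_pow, map_pow, aeval_e_succ_eq, hs, hbr, mul_comm]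
    have hE : ∀ z : B, carlitzE F d z ^ Nat.card F - carlitzE F d z =
        algebraMap F[X] B (bracket F (d + 1)) * carlitzE F (d + 1) z := fun z => by
      have h4 := pow_ne_zero (Nat.card F) (algebraMap_D_ne_zero (F := F) (B := B) d)
      have h5 := algebraMap_bracket_succ_ne_zero (F := F) (B := B) d
      rw [carlitzE, carlitzE, aeval_e_succ_eq, hDs]
      simp only [carlitzE]
      field_simp
    refine ⟨hs, hDs, hE, fun z => ?_⟩
    have h5 := algebraMap_bracket_succ_ne_zero (F := F) (B := B) d
    apply mul_left_cancel₀ h5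
    have h6 := hE z
    rw [← hE, h1, frobenius_add (F := F), mul_pow, ← pow_mul, ← pow_succ, mul_add,
      mul_left_comm, ← h6, hbr]
    linear_combination h2 z
  have main : (∀ z : B, carlitzE F d z ^ Nat.card F - carlitzE F d z =
        algebraMap F[X] B (bracket F (d + 1)) * carlitzE F (d + 1) z) ∧
      (∀ z : B, carlitzE F (d + 1) (θ * z) =
        θ ^ Nat.card F ^ (d + 1) * carlitzE F (d + 1) z + carlitzE F d z) ∧
      (algebraMap F[X] B (D F (d + 1)) =
        algebraMap F[X] B (bracket F (d + 1)) * algebraMap F[X] B (D F d) ^ Nat.card F) := by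
    induction d with
    | zero =>
      have h := key 0 (fun _ => 0) (by simp [carlitzE_zero])
        (by simp [(Nat.zero_lt_of_lt (Finite.one_lt_card (α := F))).ne'])
      exact ⟨h.2.2.1, h.2.2.2, h.2.1⟩
    | succ d ih =>
      have h := key (d + 1) (carlitzE F d) ih.2.1 (by simpa only [hbr] using ih.1)
      exact ⟨h.2.2.1, h.2.2.2, h.2.1⟩
  exact ⟨main.2.2, main.1, main.2.1⟩

theorem carlitzE_theta_mul (d : ℕ) (z : B) :
    carlitzE F (d + 1) (algebraMap F[X] B Polynomial.X * z) =
      algebraMap F[X] B Polynomial.X ^ Nat.card F ^ (d + 1) * carlitzE F (d + 1) z +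
        carlitzE F d z :=
  (carlitzE_recursion d).2.2 z

theorem D_succ (d : ℕ) : D F (d + 1) = bracket F (d + 1) * D F d ^ Nat.card F := by
  apply FaithfulSMul.algebraMap_injective F[X] (RatFunc F)
  rw [(carlitzE_recursion d).1, map_mul, map_pow]

theorem D_eq (d : ℕ) :
    D F d = (∏ i ∈ Finset.range d, bracket F (i + 1)) *
      ∏ i ∈ Finset.range d, D F i ^ (Nat.card F - 1) := by
  induction d with
  | zero =>
    apply FaithfulSMul.algebraMap_injective F[X] (RatFunc F)
    rw [← aeval_e_X_pow, aeval_e_zero]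
    simp
  | succ d ih =>
    have hq : 1 < Nat.card F := Finite.one_lt_card
    rw [D_succ, Finset.prod_range_succ, Finset.prod_range_succ, mul_mul_mul_comm, ← ih,
      mul_left_comm, ← pow_succ', Nat.sub_add_cancel hq.le]

end CarlitzBinomial

/-! ### Divisors of [1]⋯[d]. -/

section LeastCommonMultiple

variable {F : Type*} [Field F] [Finite F]

theorem kappa_mul_prod_bracket (d : ℕ) :
    (-1) ^ d * kappa F d * ∏ i ∈ Finset.range d, bracket F (i + 1) = D F d := by
  rw [D_eq, kappa, ← mul_assoc, ← mul_pow]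
  simp [mul_comm]

theorem kappa_ne_zero (d : ℕ) : kappa F d ≠ 0 := fun h => by
  have := kappa_mul_prod_bracket (F := F) d
  rw [h, mul_zero, zero_mul] at this
  exact (D_monic d).ne_zero this.symm

theorem dvd_bracket {P : F[X]} (hP : Irreducible P) {n : ℕ} (h : P.natDegree ∣ n) :
    P ∣ bracket F n :=
  hP.natDegree_dvd_iff_dvd_X_pow_card_pow_sub_X.1 h

/-- With m = deg P, the k distinct factors [m], [2m], ..., [km] are all divisible by P. -/
theorem pow_dvd_prod_bracket {P : F[X]} (hP : Irreducible P) {k d : ℕ}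
    (h : P.natDegree * k ≤ d) : P ^ k ∣ ∏ i ∈ Finset.range d, bracket F (i + 1) := by
  have hm : 0 < P.natDegree := hP.natDegree_pos
  induction k generalizing d with
  | zero => simp
  | succ k ih =>
    have hd : 0 < d := (Nat.mul_pos hm k.succ_pos).trans_le h
    rw [pow_succ]
    rw [mul_add, mul_one] at h
    have h1 : P ^ k ∣ ∏ i ∈ Finset.range (P.natDegree * k + P.natDegree - 1), bracket F (i + 1) :=
      ih (by omega)
    have h2 := mul_dvd_mul h1 (dvd_bracket hP (n := P.natDegree * k + P.natDegree) (by simp))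
    have h3 : P.natDegree * k + P.natDegree = P.natDegree * k + P.natDegree - 1 + 1 := by omega
    nth_rewrite 2 [h3] at h2
    rw [← Finset.prod_range_succ] at h2
    refine h2.trans (Finset.prod_dvd_prod_of_subset _ _ _ ?_)
    exact Finset.range_subset_range.2 (by omega)

theorem dvd_prod_bracket {a : F[X]} (ha : a ≠ 0) {d : ℕ} (h : a.natDegree ≤ d) :
    a ∣ ∏ i ∈ Finset.range d, bracket F (i + 1) := by
  classical
  induction a using UniqueFactorizationMonoid.induction_on_coprime with
  | h0 => exact absurd rfl ha
  | h1 hx => exact hx.dvd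
  | hpr i hp => exact pow_dvd_prod_bracket hp.irreducible (by
      rwa [Polynomial.natDegree_pow, mul_comm] at h)
  | hcp hxy hx hy =>
    have hx0 := left_ne_zero_of_mul ha
    have hy0 := right_ne_zero_of_mul ha
    rw [Polynomial.natDegree_mul hx0 hy0] at h
    exact hxy.isCoprime.mul_dvd (hx hx0 (by omega)) (hy hy0 (by omega))

end LeastCommonMultiple

/-! ### Interpolation on A_+(d) and the value of L_d. -/

section Lagrange

theorem degree_C_mul_le {R : Type*} [Semiring R] (c : R) (p : R[X]) :
    (Polynomial.C c * p).degree ≤ p.degree := by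
  rw [← Polynomial.smul_eq_C_mul]
  exact Polynomial.degree_smul_le c p

variable {F : Type*} [Field F] [Finite F] {B : Type*} [Field B] [Algebra F[X] B]
  [FaithfulSMul F[X] B] [Algebra F B] [IsScalarTower F F[X] B]

omit [FaithfulSMul F[X] B] in
theorem prod_monics_X_sub_C (d : ℕ) :
    ∏ a ∈ monics F d, (Polynomial.X - Polynomial.C (algebraMap F[X] B a)) =
      Polynomial.aeval (Polynomial.X : B[X]) (e F d) - Polynomial.C (algebraMap F[X] B (D F d)) := by
  rw [← Polynomial.algebraMap_apply, ← aeval_e_X_pow, ← aeval_e_sub, prod_monics, aeval_e]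
  refine Finset.prod_congr rfl fun a _ => ?_
  rw [map_add, map_add, Polynomial.algebraMap_apply, Polynomial.algebraMap_apply]
  ring

-- The product is the derivative at b of the nodal polynomial e_d(z) - D_d, and that derivative is
-- constant. All Lagrange denominators on A_+(d) therefore coincide.
open scoped Classical in
omit [FaithfulSMul F[X] B] in
theorem prod_erase_sub {d : ℕ} {b : F[X]} (hb : b ∈ monics F d) :
    ∏ a ∈ (monics F d).erase b, (algebraMap F[X] B b - algebraMap F[X] B a) =
      algebraMap F[X] B (kappa F d) := by
  have h := Lagrange.eval_nodal_derivative_eval_node_eq (v := algebraMap F[X] B) hb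
  rw [Lagrange.eval_nodal] at h
  rw [← h, Lagrange.nodal, prod_monics_X_sub_C, Polynomial.derivative_sub, derivative_aeval_e]
  simp

omit [FaithfulSMul F[X] B] in
theorem eval_M {d : ℕ} (f : F[X] → B) {b : F[X]} (hb : b ∈ monics F d) :
    (M d f).eval (algebraMap F[X] B b) = f b * algebraMap F[X] B (kappa F d) := by
  classical
  rw [M, Polynomial.eval_finsetSum, Finset.sum_eq_single_of_mem b hb]
  · simp [Polynomial.eval_prod, ← prod_erase_sub hb]
  · intro c hc hcb
    rw [Polynomial.eval_mul, Polynomial.eval_prod,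
      Finset.prod_eq_zero (Finset.mem_erase.2 ⟨hcb.symm, hb⟩) (by simp), mul_zero]

omit [FaithfulSMul F[X] B] [Algebra F B] [IsScalarTower F F[X] B] in
theorem degree_M_lt (d : ℕ) (f : F[X] → B) : (M d f).degree < (Nat.card F ^ d : ℕ) := by
  classical
  rw [M]
  refine (Polynomial.degree_sum_le _ _).trans_lt ((Finset.sup_lt_iff (WithBot.bot_lt_coe _)).2 ?_)
  intro b hb
  refine (degree_C_mul_le _ _).trans_lt ?_
  rw [Polynomial.degree_prod]
  simp only [Polynomial.degree_X_sub_C, Finset.sum_const, Finset.card_erase_of_mem hb, card_monics]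
  have : 0 < Nat.card F ^ d := pow_pos Nat.card_pos d
  rw [nsmul_one]
  exact_mod_cast Nat.sub_lt this one_pos

theorem M_eq_of_interpolates {d : ℕ} {f : F[X] → B} {P : B[X]}
    (hP : P.degree < (Nat.card F ^ d : ℕ))
    (h : ∀ b ∈ monics F d, P.eval (algebraMap F[X] B b) = f b) :
    M d f = Polynomial.C (algebraMap F[X] B (kappa F d)) * P := by
  classical
  have hcard : ((monics F d).image (algebraMap F[X] B)).card = Nat.card F ^ d := by
    rw [Finset.card_image_of_injective _ (FaithfulSMul.algebraMap_injective F[X] B), card_monics]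
  apply Polynomial.eq_of_degrees_lt_of_eval_finset_eq ((monics F d).image (algebraMap F[X] B))
  · rw [hcard]; exact degree_M_lt d f
  · rw [hcard]; exact (degree_C_mul_le _ _).trans_lt hP
  · intro x hx
    obtain ⟨b, hb, rfl⟩ := Finset.mem_image.1 hx
    rw [eval_M f hb, Polynomial.eval_mul, Polynomial.eval_C, h b hb, mul_comm]

-- Interpolation of the constant function 1, read off at z = 0.
open scoped Classical in
theorem sum_prod_erase_neg (d : ℕ) :
    ∑ b ∈ monics F d, ∏ a ∈ (monics F d).erase b, -a = kappa F d := by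
  apply FaithfulSMul.algebraMap_injective F[X] (RatFunc F)
  have h := M_eq_of_interpolates (F := F) (B := RatFunc F) (d := d) (f := 1) (P := 1)
    (by rw [Polynomial.degree_one]; exact_mod_cast pow_pos Nat.card_pos d) (by simp)
  have h' := congrArg (Polynomial.eval 0) h
  simpa [M, Polynomial.eval_finsetSum, Polynomial.eval_prod, map_sum, map_prod] using h'

/-- In the expansion of `kappa F d`, the summand of b is ± D_d / b, and b divides L_d. -/
theorem D_dvd_L_mul_kappa (d : ℕ) : D F d ∣ L F d * kappa F d := by
  classical
  rw [← sum_prod_erase_neg, Finset.mul_sum]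
  refine Finset.dvd_sum fun b hb => ?_
  obtain ⟨l, hl⟩ := (L_dvd_iff F d (L F d)).1 dvd_rfl b (mem_monics.1 hb).1
  have h : D F d = b * ∏ a ∈ (monics F d).erase b, a := (Finset.mul_prod_erase _ _ hb).symm
  rw [h, hl, mul_assoc]
  refine mul_dvd_mul_left _ (Dvd.dvd.mul_left ?_ _)
  rw [Finset.prod_neg]
  exact dvd_mul_left _ _

/-- Carlitz's formula for the least common multiple of the polynomials of degree `d`. -/
theorem L_eq (d : ℕ) : L F d = ∏ i ∈ Finset.range d, bracket F (i + 1) := by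
  refine Polynomial.eq_of_monic_of_associated (L_monic F d)
    (Polynomial.monic_prod_of_monic _ _ fun i _ => bracket_succ_monic i)
    (associated_of_dvd_dvd ((L_dvd_iff F d _).2 fun a ha => ?_) ?_)
  · exact dvd_prod_bracket (by rintro rfl; simp at ha) (Polynomial.natDegree_eq_of_degree_eq_some ha).le
  -- Up to sign D_d is `kappa F d` times [1]⋯[d]; cancelling `kappa F d` leaves [1]⋯[d] dividing
  -- L_d.
  · have h := D_dvd_L_mul_kappa (F := F) d
    rw [← kappa_mul_prod_bracket, mul_assoc, (isUnit_one.neg.pow d).mul_left_dvd, mul_comm (L F d)]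
      at h
    exact (mul_dvd_mul_iff_left (kappa_ne_zero d)).1 h

/-- The Wagner coefficient of `f` is the value at `0` of the polynomial interpolating `f` on the
monic polynomials of degree `d`. -/
theorem wagnerCoeff_eq_of_interpolates {d : ℕ} {f : F[X] → B} {P : B[X]}
    (hP : P.degree < (Nat.card F ^ d : ℕ))
    (h : ∀ b ∈ monics F d, P.eval (algebraMap F[X] B b) = f b) :
    wagnerCoeff d f = P.eval 0 := by
  have hD : algebraMap F[X] B (D F d) ≠ 0 := algebraMap_D_ne_zero d
  rw [wagnerCoeff, M_eq_of_interpolates hP h, Polynomial.eval_mul, Polynomial.eval_C]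
  have h1 := congrArg (algebraMap F[X] B) (kappa_mul_prod_bracket (F := F) d)
  rw [← L_eq] at h1
  simp only [map_mul, map_pow, map_neg, map_one] at h1
  field_simp
  linear_combination (P.eval 0) * h1

end Lagrange

/-! ### Finite expansion of χ_t and its Wagner coefficients. -/

section QuasiCharacter

variable {F : Type*} [Field F] [Finite F] {B : Type*} [Field B] [Algebra F[X] B]
  [FaithfulSMul F[X] B] [Algebra F B] [IsScalarTower F F[X] B]

variable (F) in
/-- The product `∏_{i < d} (t - θ ^ q ^ i)`, which is the Wagner coefficient of evaluation at `t`. -/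
noncomputable def evalCoeff (t : B) (d : ℕ) : B :=
  ∏ i ∈ Finset.range d, (t - algebraMap F[X] B Polynomial.X ^ Nat.card F ^ i)

theorem sum_evalCoeff_mul_carlitzE (t : B) {n : ℕ} {a : F[X]} (ha : a.degree < n) :
    ∑ j ∈ Finset.range n, evalCoeff F t j * carlitzE F j (algebraMap F[X] B a) =
      Polynomial.aeval t a := by
  induction n generalizing a with
  | zero =>
    have : a = 0 := by simpa using ha
    simp [this]
  | succ n ih =>
    have hdiv : a.divX.degree < n := by
      rw [Polynomial.degree_lt_iff_coeff_zero] at ha ⊢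
      intro m hm
      rw [Polynomial.coeff_divX]
      exact ha _ (by omega)
    have hzero : carlitzE F n (algebraMap F[X] B a.divX) = 0 := carlitzE_eq_zero hdiv
    have hC : ∑ j ∈ Finset.range (n + 1),
        evalCoeff F t j * carlitzE F j (algebraMap F[X] B (Polynomial.C (a.coeff 0))) =
        algebraMap F B (a.coeff 0) := by
      rw [Finset.sum_range_succ', Finset.sum_eq_zero, carlitzE_zero]
      · simp [evalCoeff, IsScalarTower.algebraMap_apply F F[X] B]
      · intro j _
        rw [carlitzE_eq_zero, mul_zero]
        exact Polynomial.degree_C_le.trans_lt (by exact_mod_cast j.succ_pos)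
    have hX : ∑ j ∈ Finset.range (n + 1),
        evalCoeff F t j * carlitzE F j (algebraMap F[X] B Polynomial.X * algebraMap F[X] B a.divX) =
        t * Polynomial.aeval t a.divX := by
      rw [← ih hdiv, Finset.mul_sum, Finset.sum_range_succ']
      simp only [carlitzE_theta_mul, mul_add, Finset.sum_add_distrib]
      rw [add_right_comm]
      -- For j = 0 the rule for θz has no lower term; this restores the missing summand of the full
      -- range.
      have h0 : evalCoeff F t 0 * carlitzE F 0 (algebraMap F[X] B Polynomial.X *
          algebraMap F[X] B a.divX) = evalCoeff F t 0 * (algebraMap F[X] B Polynomial.X ^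
            Nat.card F ^ 0 * carlitzE F 0 (algebraMap F[X] B a.divX)) := by
        simp [carlitzE_zero]
      rw [h0, ← Finset.sum_range_succ' (fun j => evalCoeff F t j * (algebraMap F[X] B Polynomial.X ^
            Nat.card F ^ j * carlitzE F j (algebraMap F[X] B a.divX))), Finset.sum_range_succ,
        hzero, mul_zero, mul_zero, add_zero, ← Finset.sum_add_distrib]
      -- Termwise this is c_j θ^(q^j) + c_(j+1) = t c_j.
      refine Finset.sum_congr rfl fun j _ => ?_
      rw [evalCoeff, evalCoeff, Finset.prod_range_succ]
      ring
    conv_lhs => rw [← Polynomial.divX_mul_X_add a]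
    conv_rhs => rw [← Polynomial.divX_mul_X_add a]
    simp only [map_add, map_mul, carlitzE_add, mul_add, Finset.sum_add_distrib, hC,
      mul_comm (algebraMap F[X] B a.divX), hX]
    simp [mul_comm]

omit [FaithfulSMul F[X] B] [Algebra F B] [IsScalarTower F F[X] B] in
theorem degree_aeval_X_e (d : ℕ) :
    (Polynomial.aeval (Polynomial.X : B[X]) (e F d)).degree = (Nat.card F ^ d : ℕ) := by
  rw [aeval_e, Polynomial.degree_prod]
  simp [Polynomial.algebraMap_apply, card_polyLT]

theorem wagnerCoeff_aeval (t : B) (d : ℕ) :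
    wagnerCoeff d (fun a : F[X] => Polynomial.aeval t a) = evalCoeff F t d := by
  have hev : ∀ j z, (Polynomial.aeval (Polynomial.X : B[X]) (e F j)).eval z =
      Polynomial.aeval z (e F j) := fun j z => by
    simp [aeval_e, Polynomial.eval_prod, Polynomial.algebraMap_apply]
  -- Since E_d = 1 on A_+(d), the top term c_d E_d is replaced by the constant c_d, which brings the
  -- degree below q^d.
  rw [wagnerCoeff_eq_of_interpolates (P := ∑ j ∈ Finset.range d,
    Polynomial.C (evalCoeff F t j / algebraMap F[X] B (D F j)) *
      Polynomial.aeval (Polynomial.X : B[X]) (e F j) + Polynomial.C (evalCoeff F t d))]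
  · rw [Polynomial.eval_add, Polynomial.eval_C, Polynomial.eval_finsetSum, Finset.sum_eq_zero,
      zero_add]
    intro j _
    rw [Polynomial.eval_mul, hev, ← map_zero (algebraMap F[X] B), aeval_e_eq_zero (by simp),
      mul_zero, map_zero]
  · refine (Polynomial.degree_add_le _ _).trans_lt (max_lt ?_ ?_)
    · refine (Polynomial.degree_sum_le _ _).trans_lt
        ((Finset.sup_lt_iff (WithBot.bot_lt_coe _)).2 fun j hj => ?_)
      refine (degree_C_mul_le _ _).trans_lt ?_
      rw [degree_aeval_X_e]
      exact_mod_cast Nat.pow_lt_pow_right Finite.one_lt_card (Finset.mem_range.1 hj)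
    · exact Polynomial.degree_C_le.trans_lt (by exact_mod_cast pow_pos Nat.card_pos d)
  · intro b hb
    have h := sum_evalCoeff_mul_carlitzE t (n := d + 1) (a := b)
      (by rw [(mem_monics.1 hb).1]; exact_mod_cast d.lt_succ_self)
    rw [Finset.sum_range_succ, carlitzE_of_monic hb, mul_one] at h
    rw [← h, Polynomial.eval_add, Polynomial.eval_C, Polynomial.eval_finsetSum]
    congr 1
    refine Finset.sum_congr rfl fun j _ => ?_
    rw [Polynomial.eval_mul, hev, Polynomial.eval_C, carlitzE]
    ring

end QuasiCharacter

/-! ### Rearranging a series of polynomials into a power series. -/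

section PowerSeries

variable {𝕜 : Type*}

theorem norm_sub_le_max [NormedField 𝕜] [IsUltrametricDist 𝕜] (x y : 𝕜) :
    ‖x - y‖ ≤ max ‖x‖ ‖y‖ := by
  simpa [sub_eq_add_neg] using IsUltrametricDist.norm_add_le_max x (-y)

/-- Submultiplicativity of the Gauss norm of radius R, for which X - v has norm max(R, |v|). -/
theorem norm_coeff_prod_X_sub_C_le [NormedField 𝕜] [IsUltrametricDist 𝕜] {ι : Type*}
    (s : Finset ι) (v : ι → 𝕜) {R : ℝ} (hR : 0 < R) (n : ℕ) :
    ‖(∏ i ∈ s, (Polynomial.X - Polynomial.C (v i))).coeff n‖ * R ^ n ≤ ∏ i ∈ s, max R ‖v i‖ := by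
  classical
  induction s using Finset.induction_on generalizing n with
  | empty =>
    simp only [Finset.prod_empty, Polynomial.coeff_one]
    split_ifs with h <;> simp [h]
  | insert i s hi ih =>
    rw [Finset.prod_insert hi, Finset.prod_insert hi, sub_mul, Polynomial.coeff_sub,
      Polynomial.coeff_C_mul]
    set p := ∏ i ∈ s, (Polynomial.X - Polynomial.C (v i))
    have hpos : 0 ≤ ∏ i ∈ s, max R ‖v i‖ := Finset.prod_nonneg fun _ _ => le_max_of_le_left hR.le
    have h1 : ‖(Polynomial.X * p).coeff n‖ * R ^ n ≤ max R ‖v i‖ * ∏ i ∈ s, max R ‖v i‖ := by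
      cases n with
      | zero =>
        rw [Polynomial.coeff_X_mul_zero, norm_zero, zero_mul]
        exact mul_nonneg (le_max_of_le_left hR.le) hpos
      | succ n =>
        rw [Polynomial.coeff_X_mul, pow_succ', mul_left_comm]
        exact mul_le_mul (le_max_left _ _) (ih n) (by positivity) (le_max_of_le_left hR.le)
    have h2 : ‖v i * p.coeff n‖ * R ^ n ≤ max R ‖v i‖ * ∏ i ∈ s, max R ‖v i‖ := by
      rw [norm_mul, mul_assoc]
      exact mul_le_mul (le_max_right _ _) (ih n) (by positivity) (le_max_of_le_left hR.le)
    refine (mul_le_mul_of_nonneg_right (norm_sub_le_max _ _)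
      (by positivity)).trans ?_
    rw [max_mul_of_nonneg _ _ (by positivity)]
    exact max_le h1 h2

/-- A series of polynomials whose coefficients are summably bounded on every polydisc converges
everywhere, and its sum is an everywhere convergent power series. -/
theorem exists_hasFPowerSeriesOnBall_tsum_eval [NontriviallyNormedField 𝕜] [CompleteSpace 𝕜]
    (P : ℕ → 𝕜[X]) (c : ℝ → ℕ → ℝ) (hc : ∀ R, 0 < R → Summable (c R))
    (hP : ∀ R, 0 < R → ∀ j n, ‖(P j).coeff n‖ * R ^ n ≤ c R j) :
    (∀ z, Summable fun j => (P j).eval z) ∧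
      ∃ p : FormalMultilinearSeries 𝕜 𝕜 𝕜,
        HasFPowerSeriesOnBall (fun z => ∑' j, (P j).eval z) p 0 ⊤ := by
  -- Passing from r to 2(r + 1) gains the geometric factor 2^(-n), which makes the double series in
  -- (j, n) summable; the + 1 keeps the radius positive.
  have hgeom : ∀ r : ℝ, 0 ≤ r → ∀ j n,
      ‖(P j).coeff n‖ * r ^ n ≤ c (2 * (r + 1)) j * (1 / 2) ^ n := by
    intro r hr j n
    have h1 : ‖(P j).coeff n‖ * r ^ n ≤ ‖(P j).coeff n‖ * (r + 1) ^ n := by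
      gcongr; linarith
    have h2 := hP (2 * (r + 1)) (by positivity) j n
    calc _ ≤ _ := h1
      _ = (‖(P j).coeff n‖ * (2 * (r + 1)) ^ n) * (1 / 2) ^ n := by
        rw [mul_assoc, ← mul_pow]; congr 2; ring
      _ ≤ _ := by gcongr
  have hc0 : ∀ R, 0 < R → ∀ j, 0 ≤ c R j := fun R hR j =>
    (by positivity : (0 : ℝ) ≤ ‖(P j).coeff 0‖ * R ^ 0).trans (hP R hR j 0)
  have hsum : ∀ z : 𝕜, Summable fun x : ℕ × ℕ => (P x.1).coeff x.2 * z ^ x.2 := by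
    intro z
    have hz : 0 < 2 * (‖z‖ + 1) := by positivity
    refine Summable.of_norm_bounded ((hc _ hz).mul_of_nonneg summable_geometric_two
      (hc0 _ hz) fun n => by positivity) fun x => ?_
    rw [norm_mul, norm_pow]
    exact hgeom _ (norm_nonneg z) x.1 x.2
  have hrow : ∀ z j, HasSum (fun n => (P j).coeff n * z ^ n) ((P j).eval z) := by
    intro z j
    rw [Polynomial.eval_eq_sum, Polynomial.sum]
    exact hasSum_sum_of_ne_finset_zero fun n hn => by
      rw [Polynomial.notMem_support_iff.1 hn, zero_mul]
  have hcol : ∀ n, Summable fun j => ‖(P j).coeff n‖ := fun n =>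
    Summable.of_nonneg_of_le (fun _ => norm_nonneg _)
      (fun j => by simpa using hP 1 one_pos j n) (hc 1 one_pos)
  have htot : ∀ z, HasSum (fun j => (P j).eval z) (∑' x : ℕ × ℕ, (P x.1).coeff x.2 * z ^ x.2) :=
    fun z => (hsum z).hasSum.prod_fiberwise (hrow z)
  refine ⟨fun z => (htot z).summable,
    FormalMultilinearSeries.ofScalars 𝕜 fun n => ∑' j, (P j).coeff n, ?_, ENNReal.zero_lt_top, ?_⟩
  · refine (FormalMultilinearSeries.radius_eq_top_of_summable_norm _ fun r => ?_).ge
    have hr : (0 : ℝ) < 2 * (r + 1) := by positivity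
    refine Summable.of_nonneg_of_le (fun n => by positivity) (fun n => ?_)
      (summable_geometric_two.mul_left (∑' j, c (2 * (r + 1)) j))
    rw [FormalMultilinearSeries.ofScalars_norm]
    calc _ ≤ (∑' j, ‖(P j).coeff n‖) * (r : ℝ) ^ n := by
          gcongr; exact norm_tsum_le_tsum_norm (hcol n)
      _ = ∑' j, ‖(P j).coeff n‖ * (r : ℝ) ^ n := tsum_mul_right.symm
      _ ≤ ∑' j, c (2 * (r + 1)) j * (1 / 2) ^ n :=
          ((hcol n).mul_right _).tsum_le_tsum (fun j => hgeom r r.2 j n) ((hc _ hr).mul_right _)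
      _ = _ := tsum_mul_right
  · intro z _
    simp only [zero_add, (htot z).tsum_eq, FormalMultilinearSeries.ofScalars_apply_eq, smul_eq_mul]
    have h := (Equiv.prodComm ℕ ℕ).hasSum_iff.2 (hsum z).hasSum
    exact h.prod_fiberwise fun n => (hcol n).of_norm.hasSum.mul_right _

end PowerSeries

/-! ### Absolute values in C_∞ and convergence. -/

section CInfty

variable {F : Type*} [Field F] [Finite F]

theorem KInfty.norm_algebraMap_polynomial {a : F[X]} (ha : a ≠ 0) :
    ‖algebraMap (RatFunc F) (KInfty F) (algebraMap F[X] (RatFunc F) a)‖ =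
      (Nat.card F : ℝ) ^ a.natDegree := by
  change ((WithZeroMulInt.toNNReal (one_lt_q F).ne_zero
    (MonoidWithZeroHom.ValueGroup₀.embedding (Valued.v.restrict
      (algebraMap (RatFunc F) (KInfty F) (algebraMap F[X] (RatFunc F) a)))) : ℝ≥0) : ℝ) = _
  classical
  rw [Valuation.embedding_restrict, KInfty.valued_algebraMap, RatFunc.inftyValuation_apply,
    RatFunc.inftyValuation.polynomial F ha,
    WithZeroMulInt.toNNReal_neg_apply _ WithZero.exp_ne_zero]
  simp [WithZero.exp]

theorem norm_algebraMap_polynomial {a : F[X]} (ha : a ≠ 0) :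
    ‖algebraMap F[X] (CInfty F) a‖ = (Nat.card F : ℝ) ^ a.natDegree := by
  change ‖CInfty.ofBar F (algebraMap (KInfty F) (KInftyBar F)
    (algebraMap (RatFunc F) (KInfty F) (algebraMap F[X] (RatFunc F) a)))‖ = _
  rw [CInfty.norm_ofBar, KInftyBar.norm_algebraMap, KInfty.norm_algebraMap_polynomial ha]

instance : FaithfulSMul F[X] (CInfty F) := by
  rw [faithfulSMul_iff_algebraMap_injective, injective_iff_map_eq_zero]
  intro a h
  by_contra ha
  have h1 := norm_algebraMap_polynomial ha
  rw [h, norm_zero] at h1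
  exact pow_ne_zero _ (Nat.cast_ne_zero.2 Nat.card_pos.ne') h1.symm

instance : IsUltrametricDist (CInfty F) := by
  rw [isUltrametricDist_iff_forall_norm_natCast_le_one]
  intro n
  -- Natural numbers are images of constants of A, of norm 0 or 1.
  rw [← map_natCast (algebraMap F[X] (CInfty F))]
  rcases eq_or_ne (n : F[X]) 0 with h | h
  · simp [h]
  · rw [norm_algebraMap_polynomial h]
    simp

theorem norm_D (d : ℕ) :
    ‖algebraMap F[X] (CInfty F) (D F d)‖ = ((Nat.card F : ℝ) ^ d) ^ Nat.card F ^ d := by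
  rw [D, map_prod, norm_prod, ← card_monics, ← Finset.prod_const]
  refine Finset.prod_congr rfl fun a ha => ?_
  rw [mem_monics] at ha
  rw [norm_algebraMap_polynomial ha.2.ne_zero, Polynomial.natDegree_eq_of_degree_eq_some ha.1]

variable (F) in
/-- A bound for the coefficients of `e_d` on the disc of radius `R`. -/
noncomputable def eBound (R : ℝ) (d : ℕ) : ℝ :=
  ∏ a ∈ polyLT F d, max R ‖algebraMap F[X] (CInfty F) a‖

theorem eBound_nonneg {R : ℝ} (hR : 0 < R) (d : ℕ) : 0 ≤ eBound F R d :=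
  Finset.prod_nonneg fun _ _ => le_max_of_le_left hR.le

/-- The translate with c = 0 gives the previous bound. In the other q - 1 translates each of the q^d
elements has degree d, hence norm q^d ≥ R. -/
theorem eBound_succ {R : ℝ} {d : ℕ} (hR : R ≤ (Nat.card F : ℝ) ^ d) :
    eBound F R (d + 1) =
      eBound F R d * (((Nat.card F : ℝ) ^ d) ^ Nat.card F ^ d) ^ (Nat.card F - 1) := by
  classical
  have := Fintype.ofFinite F
  rw [eBound, prod_polyLT_succ, ← Finset.mul_prod_erase _ _ (Finset.mem_univ (0 : F))]
  congr 1
  · simp [eBound]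
  · have h : ∀ c ∈ Finset.univ.erase (0 : F), ∏ a ∈ polyLT F d,
        max R ‖algebraMap F[X] (CInfty F) (a + Polynomial.C c * Polynomial.X ^ d)‖ =
        ((Nat.card F : ℝ) ^ d) ^ Nat.card F ^ d := by
      intro c hc
      have hc0 : c ≠ 0 := Finset.ne_of_mem_erase hc
      rw [← card_polyLT, ← Finset.prod_const]
      refine Finset.prod_congr rfl fun a ha => ?_
      have hd : (a + Polynomial.C c * Polynomial.X ^ d).degree = (d : WithBot ℕ) := by
        rw [Polynomial.degree_add_eq_right_of_degree_lt] <;>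
          rw [Polynomial.degree_C_mul_X_pow d hc0]
        exact mem_polyLT.1 ha
      rw [norm_algebraMap_polynomial (by intro h; simp [h] at hd),
        Polynomial.natDegree_eq_of_degree_eq_some hd, max_eq_right hR]
    rw [Finset.prod_congr rfl h, Finset.prod_const, Finset.card_erase_of_mem (Finset.mem_univ _),
      Finset.card_univ, Nat.card_eq_fintype_card]

theorem norm_sub_theta_pow_le {t : CInfty F} (ht : ‖t‖ < Nat.card F) (d : ℕ) :
    ‖t - algebraMap F[X] (CInfty F) Polynomial.X ^ Nat.card F ^ d‖ ≤
      (Nat.card F : ℝ) ^ Nat.card F ^ d := by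
  refine (norm_sub_le_max _ _).trans (max_le (ht.le.trans ?_) ?_)
  · exact le_self_pow₀ (by exact_mod_cast Nat.card_pos) (pow_pos Nat.card_pos d).ne'
  · rw [norm_pow, CInfty.norm_theta]

theorem summable_norm_mul_eBound {t : CInfty F} (ht : ‖t‖ < Nat.card F) {R : ℝ} (hR : 0 < R) :
    Summable fun d => ‖evalCoeff F t d / algebraMap F[X] (CInfty F) (D F d)‖ * eBound F R d := by
  have hq : 1 < Nat.card F := Finite.one_lt_card
  have hq' : (1 : ℝ) < Nat.card F := by exact_mod_cast hq
  refine summable_of_ratio_norm_eventually_le (r := (Nat.card F : ℝ)⁻¹) (inv_lt_one_of_one_lt₀ hq') ?_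
  filter_upwards [(tendsto_pow_atTop_atTop_of_one_lt hq').eventually_ge_atTop R] with d hd
  have h0 := eBound_nonneg (F := F) hR d
  rw [norm_mul, norm_mul, norm_norm, norm_norm, Real.norm_of_nonneg (eBound_nonneg hR _),
    Real.norm_of_nonneg h0, eBound_succ hd, norm_div, norm_div, norm_D, norm_D, evalCoeff,
    Finset.prod_range_succ, norm_mul, ← evalCoeff]
  have h1 := norm_sub_theta_pow_le ht d
  set u := ‖t - algebraMap F[X] (CInfty F) Polynomial.X ^ Nat.card F ^ d‖
  set N := Nat.card F ^ d with hN
  have hNpos : 0 < N := pow_pos (by omega) d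
  -- With N = q^d, the growth of |D_d| absorbs the growth q^(dN(q-1)) of `eBound` and the factor q^N
  -- from c_(d+1), leaving the ratio q^(-N(q-1)) ≤ 1/q.
  have h2 : ((Nat.card F : ℝ) ^ (d + 1)) ^ Nat.card F ^ (d + 1) =
      ((Nat.card F : ℝ) ^ d) ^ N * (((Nat.card F : ℝ) ^ d) ^ N) ^ (Nat.card F - 1) *
        ((Nat.card F : ℝ) ^ N * (Nat.card F : ℝ) ^ (N * (Nat.card F - 1))) := by
    rw [← pow_succ', Nat.sub_add_cancel hq.le, ← pow_add, add_comm N, ← Nat.mul_add_one,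
      Nat.sub_add_cancel hq.le, pow_succ, mul_pow, pow_succ, ← hN, pow_mul]
  have h3 : (Nat.card F : ℝ) ≤ (Nat.card F : ℝ) ^ (N * (Nat.card F - 1)) :=
    le_self_pow₀ hq'.le (Nat.mul_pos hNpos (by omega)).ne'
  rw [h2]
  have hQ : 0 < ((Nat.card F : ℝ) ^ d) ^ N := by positivity
  set Q := ((Nat.card F : ℝ) ^ d) ^ N
  set b := ‖evalCoeff F t d‖
  have hb : 0 ≤ b := norm_nonneg _
  have hqpos : (0 : ℝ) < Nat.card F := by positivity
  calc _ = (b * eBound F R d / Q) * (u / (Nat.card F : ℝ) ^ N) *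
        ((Nat.card F : ℝ) ^ (N * (Nat.card F - 1)))⁻¹ := by
        field_simp
    _ ≤ (b * eBound F R d / Q) * 1 * (Nat.card F : ℝ)⁻¹ := by
        gcongr
        exact div_le_one_of_le₀ h1 (by positivity)
    _ = _ := by ring

end CInfty

end Wagner

theorem theorem4p2p6 {F : Type*} [Field F] [Finite F] (t : Wagner.CInfty F)
    (ht : ‖t‖ < (Nat.card F : ℝ)) :
    ∃ W : Wagner.CInfty F → Wagner.CInfty F,
      (∀ z : Wagner.CInfty F, HasSum (Wagner.wagnerTerm (Wagner.chi t) z) (W z)) ∧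
      (∃ p : FormalMultilinearSeries (Wagner.CInfty F) (Wagner.CInfty F) (Wagner.CInfty F),
        HasFPowerSeriesOnBall W p 0 ⊤) ∧
      ∀ a : Polynomial F, W (algebraMap (Polynomial F) (Wagner.CInfty F) a) = Wagner.chi t a := by
  set P : ℕ → (Wagner.CInfty F)[X] := fun j =>
    Polynomial.C (Wagner.evalCoeff F t j / algebraMap F[X] (Wagner.CInfty F) (Wagner.D F j)) *
      ∏ a ∈ Wagner.polyLT F j, (Polynomial.X - Polynomial.C (algebraMap F[X] (Wagner.CInfty F) a))
    with hPdef
  have hterm : ∀ z j, Wagner.wagnerTerm (Wagner.chi t) z j =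
      Wagner.evalCoeff F t j * Wagner.carlitzE F j z := fun z j => by
    rw [Wagner.wagnerTerm, ← Wagner.wagnerCoeff_aeval]
    rfl
  have hev : ∀ z j, (P j).eval z = Wagner.wagnerTerm (Wagner.chi t) z j := fun z j => by
    rw [hterm, Wagner.carlitzE, Wagner.aeval_e]
    simp only [hPdef, Polynomial.eval_mul, Polynomial.eval_prod, Polynomial.eval_C,
      Polynomial.eval_sub, Polynomial.eval_X]
    ring
  obtain ⟨hsum, p, hp⟩ := Wagner.exists_hasFPowerSeriesOnBall_tsum_eval P _
    (fun R hR => Wagner.summable_norm_mul_eBound ht hR) (fun R hR j n => by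
      rw [hPdef, Polynomial.coeff_C_mul, norm_mul, mul_assoc]
      exact mul_le_mul_of_nonneg_left (Wagner.norm_coeff_prod_X_sub_C_le _ _ hR n) (norm_nonneg _))
  refine ⟨fun z => ∑' j, (P j).eval z, fun z => ?_, ⟨p, hp⟩, fun a => ?_⟩
  · simpa only [hev] using (hsum z).hasSum
  · have ha : a.degree < (a.natDegree + 1 : ℕ) :=
      Polynomial.degree_le_natDegree.trans_lt (by exact_mod_cast a.natDegree.lt_succ_self)
    simp only [hev, hterm]
    -- At a in A the terms with j > deg a vanish, so the sum is the finite expansion of a(t).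
    rw [tsum_eq_sum (s := Finset.range (a.natDegree + 1)), Wagner.sum_evalCoeff_mul_carlitzE t ha]
    · rfl
    · intro j hj
      rw [Wagner.carlitzE_eq_zero, mul_zero]
      exact ha.trans_le (by exact_mod_cast not_lt.1 (Finset.mem_range.not.1 hj))
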